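/- Let $G$ be a finite nilpotent group and let $p$ be a prime. Suppose that the $p$-part of $|G|$ is $p^t$ with $t>2$, and let $C$ be a conjugacy class of $G$ with exactly $p^{t-2}$ elements. Regard $C$ as a rack under the operation $a\triangleright b=aba^{-1}$, and let $\mathcal R(C)$ be its subrack lattice, that is, the set of all subracks of $C$ (including $\emptyset$ and $C$) ordered by inclusion. Then $\mathcal R(C)$ is pure of length $(p-1)(t-2)+1$, that is, every maximal chain of $\mathcal R(C)$ has exactly $(p-1)(t-2)+2$ elements. Moreover, let $\rho$ be the rank function of $\mathcal R(C)$, that is, the unique function $\rho:\mathcal R(C)\to\{0,1,\dots,(p-1)(t-2)+1\}$ with $\rho(x)=0$ for $x$ minimal and $\rho(y)=\rho(x)+1$ whenever $y$ covers $x$. Then, for every integer $1\le k\le t-2$, the subposet of $\mathcal R(C)$ consisting of all elements $x$ with $$(p-1)(k-1)+1\le\rho(x)\le(p-1)k$$ is isomorphic to the disjoint union of $p^{t-2-k}$ copies of $\overline{B_p}$ (elements of distinct copies being incomparable), where $\overline{B_p}$ is the poset of all nonempty proper subsets of $\{1,\dots,p\}$ ordered by inclusion. -/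

import Mathlib

open scoped Quandles

/-- A subrack of a rack `R`: a (possibly empty) subset closed under the rack operation and its
inverse. (For finite `R`, closure under `◃` alone is equivalent.) -/
@[ext]
structure Subrack (R : Type*) [Rack R] where
  carrier : Set R
  act_mem : ∀ {x y : R}, x ∈ carrier → y ∈ carrier → x ◃ y ∈ carrier
  invAct_mem : ∀ {x y : R}, x ∈ carrier → y ∈ carrier → x ◃⁻¹ y ∈ carrier

/-- Subracks are ordered by inclusion; this is the subrack lattice of `R` as a poset. -/
instance Subrack.instPartialOrder (R : Type*) [Rack R] : PartialOrder (Subrack R) :=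
  PartialOrder.lift Subrack.carrier (fun _ _ h => Subrack.ext h)

/-- The underlying set of the conjugacy class rack of `C`. -/
def ConjClassRack {G : Type*} [Group G] (C : ConjClasses G) : Type _ := {g : G // g ∈ C.carrier}

theorem ConjClasses.conj_mem_carrier {G : Type*} [Group G] {C : ConjClasses G} {b : G}
    (a : G) (hb : b ∈ C.carrier) : a * b * a⁻¹ ∈ C.carrier := by
  rw [ConjClasses.mem_carrier_iff_mk_eq] at hb ⊢
  rw [← hb, ConjClasses.mk_eq_mk_iff_isConj]
  exact (isConj_iff.2 ⟨a, rfl⟩).symm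

/-- The conjugacy class rack: `a ◃ b = a * b * a⁻¹` on a conjugacy class `C`. -/
instance ConjClassRack.instQuandle {G : Type*} [Group G] (C : ConjClasses G) :
    Quandle (ConjClassRack C) where
  act a b := ⟨a.1 * b.1 * a.1⁻¹, ConjClasses.conj_mem_carrier a.1 b.2⟩
  self_distrib {a b c} := Subtype.ext (by simp [mul_assoc])
  invAct a b := ⟨a.1⁻¹ * b.1 * a.1, by
    simpa using ConjClasses.conj_mem_carrier a.1⁻¹ b.2⟩
  left_inv a b := Subtype.ext (by simp [mul_assoc])
  right_inv a b := Subtype.ext (by simp [mul_assoc])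
  fix {a} := Subtype.ext (by simp)

/-- A poset is pure of length `n` if all its maximal chains have length `n`, that is, have
`n + 1` elements. -/
def IsPureOfLength (P : Type*) [PartialOrder P] (n : ℕ) : Prop :=
  ∀ c : Set P, IsMaxChain (· ≤ ·) c → c.encard = n + 1

/-- `ρ : P → {0, …, n}` is a rank function: it vanishes on minimal elements and goes up by one
along each covering relation. -/
structure IsRankFunction {P : Type*} [PartialOrder P] (n : ℕ) (ρ : P → ℕ) : Prop where
  le_length : ∀ x, ρ x ≤ n
  eq_zero_of_isMin : ∀ x, IsMin x → ρ x = 0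
  eq_add_one_of_covBy : ∀ x y, x ⋖ y → ρ y = ρ x + 1

/-- The proper part of a bounded poset. -/
abbrev ProperPart (P : Type*) [PartialOrder P] [BoundedOrder P] : Type _ :=
  {x : P // x ≠ ⊥ ∧ x ≠ ⊤}

/-- The disjoint union of `m` copies of a poset `P`: elements of distinct copies are
incomparable (this is the default order of Mathlib on sigma types). -/
abbrev Copies (m : ℕ) (P : Type*) [PartialOrder P] : Type _ := Σ _ : Fin m, P

/-! ### Conjugacy classes and the derived subgroup of a p-group. -/

open scoped commutatorElement

/-! Put n = t - 2. A finite nilpotent group is the product of its Sylow subgroups, and the factors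
away from p centralize a class of p-power size, so C can be moved into a group of order p^(n+2).
There the derived subgroup has order at most p^n and every class lies in one of its cosets; hence a
class of size p^n is a full coset of G'.

For n > 0 take a maximal subgroup N containing a point of C. It contains all of C and inherits the
hypothesis, so C splits into p classes of N, each a coset of N'. A subrack inside one of them is
handled by induction. A subrack meeting two of them generates N, hence is a union of classes of N.
So the subracks of C are the sets of leaves, in the complete p-ary tree of depth n, lying below some
(possibly no) children of one vertex: `exists_tree_parametrization`.

The rest is combinatorics. A nonempty set of this kind has s * p^j elements with 1 ≤ s < p, and its
rank is (p - 1) * j + s (`IsBranchSet.leafRank_of_cover`). The k-th band of ranks therefore consists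
of the nonempty proper sets of children of the p^(n-k) vertices whose subtrees have depth k
(`IsBranchSet.exists_level`). -/

theorem card_conjugatesOf_mul_card_centralizer {G : Type*} [Group G] [Finite G] (x : G) :
    Nat.card (conjugatesOf x) * Nat.card (Subgroup.centralizer {x}) = Nat.card G := by
  have h : conjugatesOf x = MulAction.orbit (ConjAct G) x := by
    ext y
    rw [ConjAct.orbit_eq_carrier_conjClasses, ConjClasses.mem_carrier_iff_mk_eq,
      ConjClasses.mk_eq_mk_iff_isConj]
    exact isConj_comm
  rw [Subgroup.nat_card_centralizer_nat_card_stabilizer, h]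
  have := (MulAction.stabilizer (ConjAct G) x).index_mul_card
  rwa [MulAction.index_stabilizer] at this

theorem mul_commutator_of_mem_conjugatesOf {G : Type*} [Group G] {x y : G}
    (h : y ∈ conjugatesOf x) : x⁻¹ * y ∈ commutator G := by
  obtain ⟨g, rfl⟩ := isConj_iff.1 h
  have : x⁻¹ * (g * x * g⁻¹) = ⁅x⁻¹, g⁆ := by simp [commutatorElement_def, mul_assoc]
  rw [this, commutator_def]
  exact Subgroup.commutator_mem_commutator (Subgroup.mem_top _) (Subgroup.mem_top _)

section PGroup

variable {G : Type*} [Group G]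

theorem ncard_leftCoset (x : G) (D : Subgroup G) : {y | x⁻¹ * y ∈ D}.ncard = Nat.card D := by
  have : {y | x⁻¹ * y ∈ D} = (fun d => x * d) '' (D : Set G) := by
    ext y
    simp
  rw [this, Set.ncard_image_of_injective _ (mul_right_injective x)]
  exact Nat.card_coe_set_eq (D : Set G) |>.symm

variable {p : ℕ} [Fact p.Prime]

theorem index_eq_prime_of_card {m : ℕ} (hG : Nat.card G = p ^ (m + 1))
    {M : Subgroup G} (hM : Nat.card M = p ^ m) : M.index = p := by
  have h := M.card_mul_index
  rw [hG, hM, pow_succ] at h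
  exact Nat.eq_of_mul_eq_mul_left (pow_pos (Fact.out : p.Prime).pos m) h

theorem ne_top_of_card_pow {m : ℕ} (hG : Nat.card G = p ^ (m + 1))
    {M : Subgroup G} (hM : Nat.card M = p ^ m) : M ≠ ⊤ := by
  rintro rfl
  rw [Subgroup.card_top, hG] at hM
  have := Nat.pow_right_injective (Fact.out : p.Prime).two_le hM
  omega

theorem normal_of_card_pow {m : ℕ} (hG : Nat.card G = p ^ (m + 1))
    {M : Subgroup G} (hM : Nat.card M = p ^ m) : M.Normal := by
  apply Subgroup.normal_of_index_eq_minFac_card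
  rw [index_eq_prime_of_card hG hM, hG, Nat.pow_minFac (Nat.succ_ne_zero m),
    (Fact.out : p.Prime).minFac_eq]

theorem commutator_le_of_card_pow {m : ℕ} (hG : Nat.card G = p ^ (m + 1))
    {M : Subgroup G} (hM : Nat.card M = p ^ m) : commutator G ≤ M := by
  have := normal_of_card_pow hG hM
  rw [← Subgroup.Normal.quotient_commutative_iff_commutator_le]
  have : IsCyclic (G ⧸ M) := isCyclic_of_prime_card (p := p) (index_eq_prime_of_card hG hM)
  infer_instance

variable [Finite G]

theorem exists_subgroup_card_pow_of_ne_top {m : ℕ} (hG : Nat.card G = p ^ (m + 1))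
    {H : Subgroup G} (hH : H ≠ ⊤) : ∃ M : Subgroup G, H ≤ M ∧ Nat.card M = p ^ m := by
  obtain ⟨k, hk, hHk⟩ := (Nat.dvd_prime_pow (Fact.out : p.Prime)).1 (hG ▸ H.card_subgroup_dvd_card)
  have hkm : k ≤ m := by
    by_contra h
    have : k = m + 1 := by omega
    exact hH (Subgroup.eq_top_of_card_eq H (by rw [hHk, hG, this]))
  obtain ⟨M, h1, h2⟩ := Sylow.exists_subgroup_card_pow_prime_le p
    (hG ▸ pow_dvd_pow p (Nat.le_succ m)) H hHk hkm
  exact ⟨M, h2, h1⟩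

/-- Otherwise G' would be the only subgroup of index p. An element outside it then lies in no proper
subgroup, so G is cyclic and G' trivial. -/
theorem card_commutator_le {n : ℕ} (hG : Nat.card G = p ^ (n + 2)) :
    Nat.card (commutator G) ≤ p ^ n := by
  have hp : p.Prime := Fact.out
  by_contra! hlt
  have : Nontrivial G := Finite.one_lt_card_iff_nontrivial.1
    (hG ▸ Nat.one_lt_pow (by omega) hp.one_lt)
  obtain ⟨M, -, hM⟩ := exists_subgroup_card_pow_of_ne_top hG (H := ⊥) bot_ne_top
  have hle := commutator_le_of_card_pow hG hM
  have hcard : p ^ (n + 1) ≤ Nat.card (commutator G) := by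
    obtain ⟨k, -, hk⟩ := (Nat.dvd_prime_pow hp).1 (hG ▸ (commutator G).card_subgroup_dvd_card)
    rw [hk] at hlt ⊢
    exact Nat.pow_le_pow_right hp.pos ((Nat.pow_lt_pow_iff_right hp.one_lt).1 hlt)
  have heq : ∀ M' : Subgroup G, Nat.card M' = p ^ (n + 1) → M' = commutator G := fun M' hM' =>
    (Subgroup.eq_of_le_of_card_ge (commutator_le_of_card_pow hG hM') (hM' ▸ hcard)).symm
  obtain ⟨y, -, hy⟩ := SetLike.exists_of_lt (lt_top_iff_ne_top.2 (ne_top_of_card_pow hG hM))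
  rw [heq M hM] at hy
  have htop : Subgroup.zpowers y = ⊤ := by
    by_contra hne
    obtain ⟨M', h1, h2⟩ := exists_subgroup_card_pow_of_ne_top hG hne
    exact hy (heq M' h2 ▸ h1 (Subgroup.mem_zpowers y))
  have hbot : commutator G = ⊥ := by
    rw [eq_bot_iff, commutator_def, Subgroup.commutator_le]
    intro a _ b _
    have ha : a ∈ Subgroup.zpowers y := htop ▸ Subgroup.mem_top a
    have hb : b ∈ Subgroup.zpowers y := htop ▸ Subgroup.mem_top b
    obtain ⟨i, rfl⟩ := ha
    obtain ⟨j, rfl⟩ := hb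
    rw [Subgroup.mem_bot, commutatorElement_eq_one_iff_commute]
    exact (Commute.refl y).zpow_zpow i j
  rw [hbot, Subgroup.card_bot] at hlt
  exact absurd (Nat.one_le_pow n p hp.pos) (by omega)

theorem conjugatesOf_eq_leftCoset {n : ℕ} (hG : Nat.card G = p ^ (n + 2)) {x : G}
    (hx : p ^ n ≤ Nat.card (conjugatesOf x)) :
    Nat.card (commutator G) = p ^ n ∧ Nat.card (conjugatesOf x) = p ^ n ∧
      ∀ y, y ∈ conjugatesOf x ↔ x⁻¹ * y ∈ commutator G := by
  have hsub : conjugatesOf x ⊆ {y | x⁻¹ * y ∈ commutator G} :=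
    fun y => mul_commutator_of_mem_conjugatesOf
  have h1 := ncard_leftCoset x (commutator G)
  have h2 := card_commutator_le hG
  have h3 := Set.ncard_le_ncard hsub
  rw [Nat.card_coe_set_eq] at hx ⊢
  have h4 := Set.eq_of_subset_of_ncard_le hsub (by omega)
  exact ⟨by omega, by omega, fun y => by rw [h4]; rfl⟩

/-- The centralizer of x has order p^2 in G and can only shrink in N. This is how the hypothesis on
class sizes descends to N. -/
theorem card_conjugatesOf_subgroup {n : ℕ} (hG : Nat.card G = p ^ (n + 3)) {N : Subgroup G}
    (hN : Nat.card N = p ^ (n + 2)) {x : G} (hx : Nat.card (conjugatesOf x) = p ^ (n + 1))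
    (hxN : x ∈ N) : p ^ n ≤ Nat.card (conjugatesOf (⟨x, hxN⟩ : N)) := by
  have hp : p.Prime := Fact.out
  have h1 := card_conjugatesOf_mul_card_centralizer x
  have h2 := card_conjugatesOf_mul_card_centralizer (⟨x, hxN⟩ : N)
  have h3 : Nat.card (Subgroup.centralizer {(⟨x, hxN⟩ : N)}) ≤
      Nat.card (Subgroup.centralizer {x}) := by
    refine Nat.card_le_card_of_injective
      (fun a => ⟨a.1.1, ?_⟩) (fun a b h => Subtype.ext (Subtype.ext (Subtype.mk.inj h)))
    have := a.2
    rw [Subgroup.mem_centralizer_singleton_iff] at this ⊢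
    exact congrArg Subtype.val this
  rw [hG, hx, show p ^ (n + 3) = p ^ (n + 1) * p ^ 2 by ring] at h1
  rw [Nat.eq_of_mul_eq_mul_left (pow_pos hp.pos _) h1] at h3
  rw [hN, pow_add] at h2
  refine Nat.le_of_mul_le_mul_right (c := p ^ 2) ?_ (pow_pos hp.pos 2)
  rw [← h2]
  exact Nat.mul_le_mul_left _ h3

end PGroup

/-- The leaves of the complete `p`-ary tree of depth `n`. -/
@[reducible] def TreeLeaf (p : ℕ) : ℕ → Type
  | 0 => Unit
  | n + 1 => Fin p × TreeLeaf p n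

/-- The sets of leaves of the complete `p`-ary tree which are empty, or consist of the leaves
below some children of a single vertex. -/
def IsBranchSet (p : ℕ) : (n : ℕ) → Set (TreeLeaf p n) → Prop
  | 0, _ => True
  | n + 1, Y => (∃ i : Fin p, ∃ Z : Set (TreeLeaf p n), IsBranchSet p n Z ∧ Y = Prod.mk i '' Z) ∨
      ∃ S : Set (Fin p), Y = Prod.fst ⁻¹' S

/-- A set closed under conjugation by its own elements and by their inverses. -/
def ConjClosed {G : Type*} [Group G] (X : Set G) : Prop :=
  ∀ a ∈ X, ∀ b ∈ X, a * b * a⁻¹ ∈ X ∧ a⁻¹ * b * a ∈ X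

/-- Both conjugates are carried along so that the step for inverses just swaps them. -/
theorem ConjClosed.conj_mem_of_mem_closure {G : Type*} [Group G] {X : Set G} (hX : ConjClosed X)
    {k : G} (hk : k ∈ Subgroup.closure X) : ∀ b ∈ X, k * b * k⁻¹ ∈ X ∧ k⁻¹ * b * k ∈ X := by
  induction hk using Subgroup.closure_induction with
  | mem a ha => exact hX a ha
  | one => simp
  | mul a c _ _ iha ihc =>
    intro b hb
    have h1 := (iha _ (ihc b hb).1).1
    have h2 := (ihc _ (iha b hb).2).2
    simp only [mul_assoc, mul_inv_rev] at h1 h2 ⊢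
    exact ⟨h1, h2⟩
  | inv a _ ih => exact fun b hb => by simpa using (ih b hb).symm

theorem conjClosed_coe_image {G : Type*} [Group G] {N : Subgroup G} {X : Set N} :
    ConjClosed ((↑) '' X : Set G) ↔ ConjClosed X := by
  have key : ∀ a : N, (a : G) ∈ ((↑) '' X : Set G) ↔ a ∈ X :=
    fun a => Subtype.val_injective.mem_set_image
  simp only [ConjClosed, Set.forall_mem_image]
  refine forall₂_congr fun a _ => forall₂_congr fun b _ => ?_
  rw [← key, ← key]
  simp

/-! ### Splitting a class along a maximal subgroup. -/

section PGroup

variable {G : Type*} [Group G] [Finite G] {p : ℕ} [Fact p.Prime]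

/-- If K were proper in N, it would lie in a subgroup M of index p in N. As a is outside G', the
intersection of M and G' is proper in M; it contains N', so by order it equals N'. But it also
contains a⁻¹b. -/
theorem subgroup_eq_of_mem_distinct_cosets {n : ℕ} {N K : Subgroup G}
    (hN : Nat.card N = p ^ (n + 2)) (hD : Nat.card (commutator N) = p ^ n) (hK : K ≤ N) {a b : G}
    (ha : a ∈ K) (hb : b ∈ K) (haG : a ∉ commutator G) (hab : a⁻¹ * b ∈ commutator G)
    (habN : a⁻¹ * b ∉ ⁅N, N⁆) : K = N := by
  have hp : p.Prime := Fact.out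
  by_contra hne
  have hne' : K.subgroupOf N ≠ ⊤ := fun h => hne (le_antisymm hK (Subgroup.subgroupOf_eq_top.1 h))
  obtain ⟨M, hKM, hM⟩ := exists_subgroup_card_pow_of_ne_top hN hne'
  have hDM := commutator_le_of_card_pow hN hM
  rw [← Subgroup.map_subtype_commutator] at habN
  set D := (commutator N).map N.subtype with hDdef
  set M₀ := M.map N.subtype with hM₀
  have hcard : ∀ H : Subgroup N, Nat.card (H.map N.subtype) = Nat.card H := fun H =>
    Subgroup.card_map_of_injective N.subtype_injective
  have hKM₀ : K ≤ M₀ := fun k hk => ⟨⟨k, hK hk⟩, hKM (Subgroup.mem_subgroupOf.2 hk), rfl⟩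
  have hDle : D ≤ M₀ ⊓ commutator G := by
    refine le_inf (Subgroup.map_mono hDM) ?_
    rw [hDdef, Subgroup.map_subtype_commutator, commutator_def]
    exact Subgroup.commutator_mono le_top le_top
  have hlt : M₀ ⊓ commutator G < M₀ :=
    lt_of_le_of_ne inf_le_left fun h => haG (inf_eq_left.1 h (hKM₀ ha))
  have hle : Nat.card (M₀ ⊓ commutator G : Subgroup G) ≤ p ^ n := by
    have hM₀card : Nat.card M₀ = p ^ (n + 1) := (hcard M).trans hM
    obtain ⟨k, hk, hk'⟩ := (Nat.dvd_prime_pow hp).1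
      (hM₀card ▸ Subgroup.card_dvd_of_le (inf_le_left : M₀ ⊓ commutator G ≤ M₀))
    rw [hk']
    refine Nat.pow_le_pow_right hp.pos ?_
    by_contra h
    have hk1 : k = n + 1 := by omega
    exact hlt.ne (Subgroup.eq_of_le_of_card_ge inf_le_left (by rw [hk', hM₀card, hk1]))
  have heq := Subgroup.eq_of_le_of_card_ge hDle (by rw [hDdef, hcard, hD]; exact hle)
  exact habN (heq ▸ ⟨M₀.mul_mem (M₀.inv_mem (hKM₀ ha)) (hKM₀ hb), hab⟩)

/-- Otherwise the class of x, being the coset xG', would contain 1. -/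
theorem not_mem_commutator_of_card_conjugatesOf {n : ℕ} (hG : Nat.card G = p ^ (n + 3)) {x : G}
    (hx : Nat.card (conjugatesOf x) = p ^ (n + 1)) : x ∉ commutator G := by
  intro hmem
  have h1 : (1 : G) ∈ conjugatesOf x :=
    ((conjugatesOf_eq_leftCoset hG hx.ge).2.2 1).2 (by simpa using hmem)
  have hx1 : x = 1 := isConj_one_left.1 h1
  subst hx1
  have : conjugatesOf (1 : G) = {1} := by
    ext y
    exact isConj_one_right
  rw [this, Nat.card_unique] at hx
  exact absurd hx (Nat.one_lt_pow (Nat.succ_ne_zero n) (Fact.out : p.Prime).one_lt).ne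

theorem exists_subgroup_card_pow_mem {n : ℕ} (hG : Nat.card G = p ^ (n + 3)) {x : G}
    (hx : Nat.card (conjugatesOf x) = p ^ (n + 1)) :
    ∃ N : Subgroup G, x ∈ N ∧ Nat.card N = p ^ (n + 2) := by
  have hne : Subgroup.zpowers x ≠ ⊤ := by
    intro h
    have hcent : Subgroup.centralizer {x} = ⊤ := by
      rw [eq_top_iff, ← h, Subgroup.zpowers_le, Subgroup.mem_centralizer_singleton_iff]
    have h1 := card_conjugatesOf_mul_card_centralizer x
    rw [hcent, Subgroup.card_top, hx] at h1
    have h2 := Nat.one_lt_pow (Nat.succ_ne_zero n) (Fact.out : p.Prime).one_lt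
    have h3 : 0 < Nat.card G := Nat.card_pos
    exact (lt_mul_of_one_lt_left h3 h2).ne' h1
  obtain ⟨N, h1, h2⟩ := exists_subgroup_card_pow_of_ne_top hG hne
  exact ⟨N, h1 (Subgroup.mem_zpowers x), h2⟩

theorem exists_coset_representatives {A D : Subgroup G} (hDA : D ≤ A) {n : ℕ}
    (hA : Nat.card A = p ^ (n + 1)) (hD : Nat.card D = p ^ n) :
    ∃ r : Fin p → G, (∀ i, r i ∈ A) ∧ (∀ g ∈ A, ∃ i, (r i)⁻¹ * g ∈ D) ∧
      ∀ i j, (r i)⁻¹ * r j ∈ D → i = j := by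
  have hD' : Nat.card (D.subgroupOf A) = p ^ n := by
    rw [← hD]
    exact Nat.card_congr (Subgroup.subgroupOfEquivOfLe hDA).toEquiv
  have hidx : Nat.card (A ⧸ D.subgroupOf A) = p := index_eq_prime_of_card hA hD'
  have q : Fin p ≃ A ⧸ D.subgroupOf A := (Finite.equivFinOfCardEq hidx).symm
  refine ⟨fun i => ((q i).out : A), fun i => (q i).out.2, fun g hg => ?_, fun i j hij => ?_⟩
  · obtain ⟨i, hi⟩ := q.surjective (QuotientGroup.mk (⟨g, hg⟩ : A))
    refine ⟨i, ?_⟩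
    rw [← QuotientGroup.out_eq' (q i), QuotientGroup.eq, Subgroup.mem_subgroupOf] at hi
    exact hi
  · apply q.injective
    rw [← QuotientGroup.out_eq' (q i), ← QuotientGroup.out_eq' (q j), QuotientGroup.eq,
      Subgroup.mem_subgroupOf]
    exact hij

end PGroup

/-- The group is quantified inside the induction because the step passes from G to N. -/
theorem exists_tree_parametrization {p : ℕ} [Fact p.Prime] (n : ℕ) :
    ∀ (G : Type*) [Group G] [Finite G], Nat.card G = p ^ (n + 2) →
      ∀ x : G, Nat.card (conjugatesOf x) = p ^ n →
      ∃ e : TreeLeaf p n → G, Function.Injective e ∧ Set.range e = conjugatesOf x ∧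
        ∀ Y, ConjClosed (e '' Y) ↔ IsBranchSet p n Y := by
  induction n with
  | zero =>
    intro G _ _ _ x hx
    rw [pow_zero, Nat.card_coe_set_eq, Set.ncard_eq_one] at hx
    obtain ⟨a, ha⟩ := hx
    have hax : x = a := by
      have : x ∈ conjugatesOf x := mem_conjugatesOf_self
      rwa [ha] at this
    subst hax
    refine ⟨fun _ => x, fun a b _ => rfl, ?_, fun Y => ?_⟩
    · rw [ha]
      exact Set.range_const
    · refine iff_of_true ?_ trivial
      rintro _ ⟨u, hu, rfl⟩ _ ⟨v, hv, rfl⟩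
      exact ⟨⟨u, hu, by simp⟩, ⟨u, hu, by simp⟩⟩
  | succ n ih =>
    intro G _ _ hG x hx
    obtain ⟨N, hxN, hN⟩ := exists_subgroup_card_pow_mem hG hx
    obtain ⟨hG', -, hC⟩ := conjugatesOf_eq_leftCoset hG hx.ge
    have hG'N := commutator_le_of_card_pow hG hN
    have hxG' := not_mem_commutator_of_card_conjugatesOf hG hx
    have hmemN : ∀ y ∈ conjugatesOf x, y ∈ N := fun y hy => by
      simpa using N.mul_mem hxN (hG'N ((hC y).1 hy))
    have hcard : ∀ y ∈ conjugatesOf x, Nat.card (conjugatesOf y) = p ^ (n + 1) := fun y hy => by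
      rw [← hx, show conjugatesOf y = conjugatesOf x from (isConj_iff_conjugatesOf_eq.1 hy).symm]
    have hNC : ∀ y (hy : y ∈ conjugatesOf x),
        Nat.card (commutator N) = p ^ n ∧
          Nat.card (conjugatesOf (⟨y, hmemN y hy⟩ : N)) = p ^ n ∧
          ∀ z, z ∈ conjugatesOf (⟨y, hmemN y hy⟩ : N) ↔
            (⟨y, hmemN y hy⟩ : N)⁻¹ * z ∈ commutator N := fun y hy =>
      conjugatesOf_eq_leftCoset hN (card_conjugatesOf_subgroup hG hN (hcard y hy) _)
    have hD := (hNC x mem_conjugatesOf_self).1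
    have hDcard : Nat.card (⁅N, N⁆ : Subgroup G) = p ^ n := by
      rw [← Subgroup.map_subtype_commutator,
        Subgroup.card_map_of_injective N.subtype_injective, hD]
    have hDG' : ⁅N, N⁆ ≤ commutator G := Subgroup.commutator_mono le_top le_top
    have hmemD : ∀ z : N, z ∈ commutator N ↔ (z : G) ∈ ⁅N, N⁆ := fun z => by
      rw [← Subgroup.map_subtype_commutator]
      exact (Subgroup.mem_map_iff_mem N.subtype_injective).symm
    -- Translating coset representatives of N' in G' by x gives one point in each of the p classes
    -- of N inside C: the children of the root.
    obtain ⟨r, hrA, hrS, hrI⟩ := exists_coset_representatives hDG' hG' hDcard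
    have hxr : ∀ i, x * r i ∈ conjugatesOf x := fun i => (hC _).2 (by simpa using hrA i)
    choose e heI heR heC using fun i =>
      ih N hN ⟨x * r i, hmemN _ (hxr i)⟩ (hNC _ (hxr i)).2.1
    have hrange : ∀ i (z : N), z ∈ Set.range (e i) ↔ (x * r i)⁻¹ * (z : G) ∈ ⁅N, N⁆ := by
      intro i z
      rw [heR i, (hNC _ (hxr i)).2.2, hmemD]
      rfl
    set E : TreeLeaf p (n + 1) → G := fun u => (e u.1 u.2 : G) with hE
    have hEI : Function.Injective E := by
      rintro ⟨i, f⟩ ⟨j, g⟩ h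
      have h' : e i f = e j g := Subtype.ext h
      have h1 := (hrange i _).1 ⟨f, rfl⟩
      have h2 := (hrange j _).1 ⟨g, rfl⟩
      rw [← h'] at h2
      obtain rfl : i = j := hrI i j (by
        simpa [mul_assoc] using mul_mem h1 (inv_mem h2))
      rw [heI i h']
    have hER : Set.range E = conjugatesOf x := by
      ext y
      rw [hC]
      constructor
      · rintro ⟨⟨i, f⟩, rfl⟩
        have h1 := mul_mem (hrA i) (hDG' ((hrange i _).1 ⟨f, rfl⟩))
        simpa [mul_assoc] using h1
      · intro hy
        obtain ⟨i, hi⟩ := hrS _ hy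
        obtain ⟨f, hf⟩ := (hrange i ⟨y, hmemN y ((hC y).2 hy)⟩).2 (by simpa [mul_assoc] using hi)
        exact ⟨(i, f), congrArg Subtype.val hf⟩
    have himage : ∀ i (Z : Set (TreeLeaf p n)), E '' (Prod.mk i '' Z) = (↑) '' (e i '' Z) := by
      intro i Z
      rw [Set.image_image, Set.image_image]
    have hEN : ∀ Y, E '' Y ⊆ N := by
      rintro Y _ ⟨u, -, rfl⟩
      exact (e u.1 u.2).2
    have hconj : ∀ i f g, ∃ c ∈ N, c * E (i, f) * c⁻¹ = E (i, g) := by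
      intro i f g
      have hf : IsConj _ (e i f) := (heR i).le ⟨f, rfl⟩
      have hg : IsConj _ (e i g) := (heR i).le ⟨g, rfl⟩
      obtain ⟨c, hc⟩ := isConj_iff.1 (hf.symm.trans hg)
      exact ⟨c, c.2, congrArg Subtype.val hc⟩
    refine ⟨E, hEI, hER, fun Y => ⟨fun hY => ?_, ?_⟩⟩
    · by_cases hdist : ∃ u ∈ Y, ∃ v ∈ Y, u.1 ≠ v.1
      · right
        obtain ⟨u, hu, v, hv, huv⟩ := hdist
        have huC : E u ∈ conjugatesOf x := hER.le ⟨u, rfl⟩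
        have hvC : E v ∈ conjugatesOf x := hER.le ⟨v, rfl⟩
        -- Two leaves below different children lie in different cosets of N' but in the same coset
        -- of G', so Y generates N and is stable under conjugation by N.
        have hK : Subgroup.closure (E '' Y) = N := by
          refine subgroup_eq_of_mem_distinct_cosets hN hD ((Subgroup.closure_le N).2 (hEN Y))
            (Subgroup.subset_closure ⟨u, hu, rfl⟩) (Subgroup.subset_closure ⟨v, hv, rfl⟩)
            (not_mem_commutator_of_card_conjugatesOf hG (hcard _ huC))
            ((conjugatesOf_eq_leftCoset hG (hcard _ huC).ge).2.2 _ |>.1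
              (IsConj.trans (IsConj.symm huC) hvC)) fun hmem => huv ?_
          have h1 := (hrange u.1 _).1 ⟨u.2, rfl⟩
          have h2 := (hrange v.1 _).1 ⟨v.2, rfl⟩
          refine hrI _ _ ?_
          simpa [hE, mul_assoc] using mul_mem (mul_mem h1 hmem) (inv_mem h2)
        refine ⟨{i | ∃ f, (i, f) ∈ Y}, Set.Subset.antisymm (fun w hw => ⟨w.2, hw⟩) ?_⟩
        rintro ⟨i, g⟩ ⟨f, hf⟩
        obtain ⟨c, hcN, hc⟩ := hconj i f g
        have := (hY.conj_mem_of_mem_closure (hK.ge hcN) _ ⟨_, hf, rfl⟩).1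
        rw [hc] at this
        exact hEI.mem_set_image.1 this
      · push Not at hdist
        rcases Y.eq_empty_or_nonempty with rfl | ⟨⟨i, f⟩, hif⟩
        · exact Or.inr ⟨∅, rfl⟩
        · left
          have hYi : Y = Prod.mk i '' {g | (i, g) ∈ Y} := by
            ext ⟨j, g⟩
            constructor
            · intro h
              obtain rfl : i = j := hdist _ hif _ h
              exact ⟨g, h, rfl⟩
            · rintro ⟨g', h, h'⟩
              rwa [← h']
          refine ⟨i, _, ?_, hYi⟩
          rw [hYi, himage, conjClosed_coe_image, heC] at hY
          exact hY
    · rintro (⟨i, Z, hZ, rfl⟩ | ⟨S, rfl⟩)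
      · rwa [himage, conjClosed_coe_image, heC]
      · have key : ∀ c ∈ N, ∀ b ∈ E '' (Prod.fst ⁻¹' S), c * b * c⁻¹ ∈ E '' (Prod.fst ⁻¹' S) := by
          rintro c hc _ ⟨⟨i, f⟩, hi, rfl⟩
          have hf : IsConj _ (e i f) := (heR i).le ⟨f, rfl⟩
          obtain ⟨g, hg⟩ := (heR i).ge (hf.trans (isConj_iff.2 ⟨(⟨c, hc⟩ : N), rfl⟩))
          exact ⟨(i, g), hi, congrArg Subtype.val hg⟩
        intro a ha b hb
        exact ⟨key a (hEN _ ha) b hb, by simpa using key a⁻¹ (N.inv_mem (hEN _ ha)) b hb⟩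

/-! ### Reduction from a nilpotent group to its Sylow subgroup. -/

theorem exists_sylow_projection {G : Type*} [Group G] [Finite G] (hG : Group.IsNilpotent G)
    {p : ℕ} [hp : Fact p.Prime] (hdvd : p ∣ Nat.card G) :
    ∃ P : Sylow p G, (P : Subgroup G).Normal ∧ ∃ π : G →* P, Function.Surjective π := by
  obtain ⟨e⟩ := (Group.isNilpotent_of_finite_tfae (G := G).out 0 4).1 hG
  have P : Sylow p G := default
  let q : (Nat.card G).primeFactors :=
    ⟨p, Nat.mem_primeFactors.2 ⟨hp.out, hdvd, Nat.card_pos.ne'⟩⟩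
  refine ⟨P, (Group.isNilpotent_of_finite_tfae.out 0 3 rfl rfl).1 hG p hp P,
    ((Pi.evalMonoidHom _ P).comp (Pi.evalMonoidHom _ q)).comp e.symm.toMonoidHom, ?_⟩
  refine ((Function.surjective_eval P).comp (Function.surjective_eval q)).comp e.symm.surjective

section Projection

variable {G : Type*} [Group G] {p : ℕ} {P : Sylow p G} {π : G →* P}

theorem card_ker_mul_card_sylow (hπ : Function.Surjective π) :
    Nat.card π.ker * Nat.card P = Nat.card G := by
  have h := π.ker.card_mul_index
  rwa [Subgroup.index_ker, MonoidHom.range_eq_top.2 hπ, Subgroup.card_top] at h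

theorem image_conjugatesOf (hπ : Function.Surjective π) (x : G) :
    π '' conjugatesOf x = conjugatesOf (π x) := by
  ext y
  constructor
  · rintro ⟨z, hz, rfl⟩
    exact π.map_isConj hz
  · intro hy
    obtain ⟨c, rfl⟩ := isConj_iff.1 hy
    obtain ⟨g, rfl⟩ := hπ c
    exact ⟨g * x * g⁻¹, isConj_iff.2 ⟨g, rfl⟩, by simp⟩

variable [Finite G] [Fact p.Prime]

theorem coprime_card_ker (hπ : Function.Surjective π) : (Nat.card π.ker).Coprime p := by
  have hp : p.Prime := Fact.out
  rw [Nat.coprime_comm, hp.coprime_iff_not_dvd]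
  intro hdvd
  have h := mul_dvd_mul hdvd (dvd_refl (Nat.card P))
  rw [card_ker_mul_card_sylow hπ, P.card_eq_multiplicity, ← pow_succ'] at h
  exact Nat.pow_succ_factorization_not_dvd Nat.card_pos.ne' hp h

/-- The kernel has order prime to p and the centralizer has index p^n, so the order of the kernel
divides that of the centralizer. The centralizer has p-group image under π, so its intersection with
the kernel already has the full order of the kernel. -/
theorem ker_le_centralizer (hπ : Function.Surjective π) {x : G} {n : ℕ}
    (hx : Nat.card (conjugatesOf x) = p ^ n) : π.ker ≤ Subgroup.centralizer {x} := by
  have hcop := coprime_card_ker hπ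
  set D := Subgroup.centralizer {x}
  have h1 : Nat.card π.ker ∣ Nat.card D := by
    refine (hcop.pow_right n).dvd_of_dvd_mul_left ?_
    rw [← hx, card_conjugatesOf_mul_card_centralizer, ← card_ker_mul_card_sylow hπ]
    exact dvd_mul_right _ _
  set φ := π.comp D.subtype
  have h2 : Nat.card φ.range ∣ p ^ (Nat.card G).factorization p :=
    P.card_eq_multiplicity ▸ Subgroup.card_subgroup_dvd_card _
  have h3 : Nat.card π.ker ∣ Nat.card φ.ker := by
    rw [← φ.ker.card_mul_index, Subgroup.index_ker] at h1
    exact ((hcop.pow_right _).coprime_dvd_right h2).dvd_of_dvd_mul_right h1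
  have h4 : φ.ker.map D.subtype ≤ π.ker := by
    rintro _ ⟨d, hd, rfl⟩
    exact hd
  have h5 : φ.ker.map D.subtype = π.ker := by
    refine Subgroup.eq_of_le_of_card_ge h4 ?_
    rw [Subgroup.card_map_of_injective D.subtype_injective]
    exact Nat.le_of_dvd Nat.card_pos h3
  rw [← h5]
  exact Subgroup.map_subtype_le _

/-- Write the conjugator as s * k with s in P and k in the kernel; k centralizes c. If c and its
conjugate have equal images, the commutator of s and c lies both in the normal subgroup P and in the
kernel, so it is trivial. -/
theorem injOn_conjugatesOf (hP : (P : Subgroup G).Normal) (hπ : Function.Surjective π) {x : G}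
    {n : ℕ} (hx : Nat.card (conjugatesOf x) = p ^ n) : Set.InjOn π (conjugatesOf x) := by
  have hcop : (Nat.card P).Coprime (Nat.card π.ker) := by
    rw [P.card_eq_multiplicity]
    exact (coprime_card_ker hπ).symm.pow_left _
  have hcompl : Subgroup.IsComplement' (P : Subgroup G) π.ker :=
    Subgroup.isComplement'_of_coprime (by rw [mul_comm]; exact card_ker_mul_card_sylow hπ) hcop
  intro c hc c' hc' h
  have hcc' : IsConj c c' := (IsConj.symm hc).trans hc'
  obtain ⟨g, rfl⟩ := isConj_iff.1 hcc'
  have hcard : Nat.card (conjugatesOf c) = p ^ n := by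
    rw [← hx, isConj_iff_conjugatesOf_eq.1 hc]
  obtain ⟨⟨s, k⟩, rfl⟩ := hcompl.2 g
  have hk : (k : G) * c * (k : G)⁻¹ = c := by
    rw [Subgroup.mem_centralizer_singleton_iff.1 (ker_le_centralizer hπ hcard k.2)]
    simp
  have hs : (s : G) * k * c * ((s : G) * k)⁻¹ = s * c * (s : G)⁻¹ := by
    rw [mul_inv_rev, ← mul_assoc, mul_assoc (s : G), mul_assoc (s : G), hk]
  simp only [hs] at h ⊢
  have h1 : (s : G) * (c * (s : G)⁻¹ * c⁻¹) ∈ (P : Subgroup G) :=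
    mul_mem s.2 (hP.conj_mem _ (inv_mem s.2) c)
  have h2 : (s : G) * (c * (s : G)⁻¹ * c⁻¹) ∈ π.ker := by
    have : (s : G) * (c * (s : G)⁻¹ * c⁻¹) = s * c * (s : G)⁻¹ * c⁻¹ := by group
    rw [MonoidHom.mem_ker, this, map_mul, ← h, map_inv, mul_inv_cancel]
  have h3 := Subgroup.disjoint_def.1 hcompl.disjoint h1 h2
  rw [← mul_assoc, ← mul_assoc, mul_inv_eq_one] at h3
  exact h3.symm

end Projection

theorem exists_conjClassRack_equiv {G : Type*} [Group G] [Finite G] (hG : Group.IsNilpotent G)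
    {p n : ℕ} (hp : p.Prime) (hpart : (Nat.card G).factorization p = n + 2)
    (C : ConjClasses G) (hC : Nat.card C.carrier = p ^ n) :
    ∃ ε : TreeLeaf p n ≃ ConjClassRack C, ∀ Y,
      (∃ X : Subrack (ConjClassRack C), X.carrier = ε '' Y) ↔ IsBranchSet p n Y := by
  have : Fact p.Prime := ⟨hp⟩
  have hdvd : p ∣ Nat.card G := Nat.dvd_of_factorization_pos (by omega)
  obtain ⟨P, hP, π, hπ⟩ := exists_sylow_projection hG hdvd
  obtain ⟨x, rfl⟩ := C.exists_rep
  have hcarrier : (ConjClasses.mk x).carrier = conjugatesOf x := by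
    ext y
    rw [ConjClasses.mem_carrier_iff_mk_eq, ConjClasses.mk_eq_mk_iff_isConj]
    exact isConj_comm
  have hx : Nat.card (conjugatesOf x) = p ^ n := by rw [← hC, ← hcarrier]
  have hinj := injOn_conjugatesOf hP hπ hx
  have himg := image_conjugatesOf hπ x
  obtain ⟨e, heI, heR, heC⟩ := exists_tree_parametrization n P
    (by rw [P.card_eq_multiplicity, hpart]) (π x)
    (by rw [← himg, Nat.card_coe_set_eq, hinj.ncard_image,
      ← Nat.card_coe_set_eq, hx])
  let β : ConjClassRack (ConjClasses.mk x) → P := fun c => π c.1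
  have hβI : Function.Injective β := fun a b h =>
    Subtype.ext (hinj (hcarrier.le a.2) (hcarrier.le b.2) h)
  have hβR : Set.range β = Set.range e := by
    rw [heR, ← himg, ← hcarrier]
    ext y
    constructor
    · rintro ⟨c, rfl⟩
      exact ⟨c.1, c.2, rfl⟩
    · rintro ⟨c, hc, rfl⟩
      exact ⟨⟨c, hc⟩, rfl⟩
  let ε : TreeLeaf p n ≃ ConjClassRack (ConjClasses.mk x) :=
    ((Equiv.ofInjective e heI).trans (Equiv.setCongr hβR.symm)).trans (Equiv.ofInjective β hβI).symm
  have hε : ∀ u, β (ε u) = e u := fun u => Equiv.apply_ofInjective_symm hβI _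
  refine ⟨ε, fun Y => ?_⟩
  have hY : e '' Y = β '' (ε '' Y) := by simp only [Set.image_image, hε]
  rw [← heC, hY]
  have hact : ∀ a b, β (a ◃ b) = β a * β b * (β a)⁻¹ := fun a b => by
    change π (a.1 * b.1 * a.1⁻¹) = _
    simp [β]
  have hinv : ∀ a b, β (a ◃⁻¹ b) = (β a)⁻¹ * β b * β a := fun a b => by
    change π (a.1⁻¹ * b.1 * a.1) = _
    simp [β]
  constructor
  · rintro ⟨X, hX⟩ _ ⟨a, ha, rfl⟩ _ ⟨b, hb, rfl⟩
    rw [← hX] at ha hb ⊢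
    rw [← hact, ← hinv]
    exact ⟨⟨_, X.act_mem ha hb, rfl⟩, ⟨_, X.invAct_mem ha hb, rfl⟩⟩
  · intro h
    refine ⟨⟨ε '' Y, fun {a b} ha hb => ?_, fun {a b} ha hb => ?_⟩, rfl⟩
    · have := (h _ ⟨a, ha, rfl⟩ _ ⟨b, hb, rfl⟩).1
      rwa [← hact, hβI.mem_set_image] at this
    · have := (h _ ⟨a, ha, rfl⟩ _ ⟨b, hb, rfl⟩).2
      rwa [← hinv, hβI.mem_set_image] at this

theorem nonempty_subrack_orderIso {G : Type*} [Group G] [Finite G] (hG : Group.IsNilpotent G)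
    {p n : ℕ} (hp : p.Prime) (hpart : (Nat.card G).factorization p = n + 2)
    (C : ConjClasses G) (hC : Nat.card C.carrier = p ^ n) :
    Nonempty (Subrack (ConjClassRack C) ≃o {Y : Set (TreeLeaf p n) // IsBranchSet p n Y}) := by
  obtain ⟨ε, hε⟩ := exists_conjClassRack_equiv hG hp hpart C hC
  refine ⟨RelIso.ofSurjective (OrderEmbedding.ofMapLEIff
    (fun X => ⟨ε ⁻¹' X.carrier, (hε _).1 ⟨X, by simp⟩⟩) fun X X' => ?_) ?_⟩
  · exact Set.preimage_subset_preimage_iff (by simp)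
  · rintro ⟨Y, hY⟩
    obtain ⟨X, hX⟩ := (hε Y).2 hY
    exact ⟨X, Subtype.ext (by simp [hX])⟩

/-! ### Cardinalities, covers and levels of branch sets. -/

instance TreeLeaf.finite (p : ℕ) : ∀ n, Finite (TreeLeaf p n)
  | 0 => inferInstanceAs (Finite Unit)
  | n + 1 => have := TreeLeaf.finite p n; inferInstanceAs (Finite (Fin p × TreeLeaf p n))

theorem TreeLeaf.ncard_univ (p n : ℕ) : (Set.univ : Set (TreeLeaf p n)).ncard = p ^ n := by
  induction n with
  | zero => rw [Set.ncard_univ, pow_zero]; exact Nat.card_unique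
  | succ n ih =>
    rw [Set.ncard_univ] at ih ⊢
    change Nat.card (Fin p × TreeLeaf p n) = _
    rw [Nat.card_prod, ih, Nat.card_fin, pow_succ']

theorem TreeLeaf.ncard_fst_preimage {p n : ℕ} (S : Set (Fin p)) :
    (Prod.fst ⁻¹' S : Set (TreeLeaf p (n + 1))).ncard = S.ncard * p ^ n := by
  rw [← Set.prod_univ, Set.ncard_prod, TreeLeaf.ncard_univ]

theorem TreeLeaf.ncard_mk_image {p n : ℕ} (i : Fin p) (Z : Set (TreeLeaf p n)) :
    (Prod.mk i '' Z : Set (TreeLeaf p (n + 1))).ncard = Z.ncard :=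
  Set.ncard_image_of_injective _ (Prod.mk_right_injective i)

theorem TreeLeaf.mk_image_univ {p n : ℕ} (i : Fin p) :
    (Prod.mk i '' Set.univ : Set (TreeLeaf p (n + 1))) = Prod.fst ⁻¹' {i} := by
  ext ⟨j, f⟩
  simp [eq_comm]

theorem TreeLeaf.nonempty {p : ℕ} (hp : 0 < p) (n : ℕ) : Nonempty (TreeLeaf p n) := by
  rw [Set.nonempty_iff_univ_nonempty, ← Set.ncard_pos, TreeLeaf.ncard_univ]
  exact pow_pos hp n

theorem TreeLeaf.fst_preimage_subset_iff {p n : ℕ} (hp : 0 < p) {S T : Set (Fin p)} :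
    (Prod.fst ⁻¹' S : Set (TreeLeaf p (n + 1))) ⊆ Prod.fst ⁻¹' T ↔ S ⊆ T := by
  obtain ⟨f⟩ := TreeLeaf.nonempty hp n
  exact Set.preimage_subset_preimage_iff fun i _ => ⟨(i, f), rfl⟩

theorem IsBranchSet.empty (p n : ℕ) : IsBranchSet p n ∅ := by
  cases n with
  | zero => trivial
  | succ n => exact Or.inr ⟨∅, rfl⟩

theorem IsBranchSet.univ (p n : ℕ) : IsBranchSet p n Set.univ := by
  cases n with
  | zero => trivial
  | succ n => exact Or.inr ⟨Set.univ, rfl⟩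

theorem IsBranchSet.of_mk_image {p n : ℕ} {i : Fin p} {Z : Set (TreeLeaf p n)}
    (h : IsBranchSet p (n + 1) (Prod.mk i '' Z)) : IsBranchSet p n Z := by
  rcases Z.eq_empty_or_nonempty with rfl | ⟨f, hf⟩
  · exact IsBranchSet.empty p n
  rcases h with ⟨j, W, hW, h⟩ | ⟨S, h⟩
  · obtain ⟨g, -, hg⟩ := h.le ⟨f, hf, rfl⟩
    obtain rfl : j = i := congrArg Prod.fst hg
    rwa [(Prod.mk_right_injective j).image_injective h]
  · have hi : i ∈ S := h.le ⟨f, hf, rfl⟩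
    have : Z = Set.univ := Set.eq_univ_of_forall fun g => by
      obtain ⟨g', hg', h'⟩ := h.ge (show ((i, g) : TreeLeaf p (n + 1)) ∈ Prod.fst ⁻¹' S from hi)
      obtain rfl : g' = g := congrArg Prod.snd h'
      exact hg'
    exact this ▸ IsBranchSet.univ p n

/-- The rank of a set of leaves with `c` elements. -/
def leafRank (p c : ℕ) : ℕ := (p - 1) * Nat.log p c + c / p ^ Nat.log p c

theorem leafRank_zero (p : ℕ) : leafRank p 0 = 0 := by simp [leafRank]

/-- The case s = p is consistent: p * p^j is 1 * p^(j+1), and (p - 1) * (j + 1) + 1 = (p - 1) * j +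
p. -/
theorem leafRank_mul_pow {p s : ℕ} (hp : 1 < p) (hs : 1 ≤ s) (hsp : s ≤ p) (j : ℕ) :
    leafRank p (s * p ^ j) = (p - 1) * j + s := by
  have hpos : 0 < p := by omega
  rcases hsp.lt_or_eq with h | rfl
  · have hlog : Nat.log p (s * p ^ j) = j := by
      rw [Nat.log_eq_iff (Or.inr ⟨hp, by positivity⟩), pow_succ']
      exact ⟨Nat.le_mul_of_pos_left _ hs, Nat.mul_lt_mul_of_pos_right h (pow_pos hpos j)⟩
    rw [leafRank, hlog, Nat.mul_div_cancel _ (pow_pos hpos j)]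
  · rw [leafRank, ← pow_succ', Nat.log_pow hp, Nat.div_self (pow_pos hpos _), mul_add]
    omega

theorem IsBranchSet.exists_ncard_eq {p : ℕ} (hp : 1 < p) {n : ℕ} {Y : Set (TreeLeaf p n)}
    (hY : IsBranchSet p n Y) (hne : Y.Nonempty) :
    ∃ s j, 1 ≤ s ∧ s < p ∧ Y.ncard = s * p ^ j ∧ j ≤ n ∧ (j = n → s = 1) := by
  induction n with
  | zero =>
    refine ⟨1, 0, le_rfl, hp, ?_, le_rfl, fun _ => rfl⟩
    rw [Subsingleton.eq_univ_of_nonempty hne]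
    simp
  | succ n ih =>
    rcases hY with ⟨i, Z, hZ, rfl⟩ | ⟨S, rfl⟩
    · obtain ⟨s, j, h1, h2, h3, h4, -⟩ := ih hZ hne.of_image
      exact ⟨s, j, h1, h2, by rw [TreeLeaf.ncard_mk_image, h3], by omega, by omega⟩
    · have hS : 1 ≤ S.ncard := by
        obtain ⟨u, hu⟩ := hne
        exact (Set.ncard_pos).2 ⟨_, hu⟩
      have hSp : S.ncard ≤ p := by
        simpa using Set.ncard_le_ncard S.subset_univ
      rw [TreeLeaf.ncard_fst_preimage]
      rcases hSp.lt_or_eq with h | h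
      · exact ⟨_, n, hS, h, rfl, by omega, by omega⟩
      · exact ⟨1, n + 1, le_rfl, hp, by rw [h, pow_succ', one_mul], le_rfl, fun _ => rfl⟩

/-- Inside one child the claim is inductive. Otherwise Y' is a union of at least two full child
blocks, and a set covered by it must be the same union with one block removed. -/
theorem IsBranchSet.leafRank_of_cover {p : ℕ} (hp : 1 < p) {n : ℕ} {Y Y' : Set (TreeLeaf p n)}
    (hY : IsBranchSet p n Y) (hY' : IsBranchSet p n Y') (hlt : Y ⊂ Y')
    (hcov : ∀ W, IsBranchSet p n W → Y ⊆ W → W ⊆ Y' → W = Y ∨ W = Y') :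
    leafRank p Y'.ncard = leafRank p Y.ncard + 1 := by
  induction n with
  | zero =>
    have hne : Y'.Nonempty := Set.nonempty_of_ssubset hlt |>.mono Set.sdiff_subset
    have h1 := Subsingleton.eq_univ_of_nonempty hne
    have h2 : Y = ∅ := by
      by_contra h
      have := Subsingleton.eq_univ_of_nonempty
        (Set.nonempty_iff_ne_empty.2 h)
      exact hlt.ne (this.trans h1.symm)
    rw [h1, h2, TreeLeaf.ncard_univ, Set.ncard_empty, leafRank_zero]
    simpa using leafRank_mul_pow hp le_rfl hp.le 0
  | succ n ih =>
    have inner : ∀ i (Z' : Set (TreeLeaf p n)), IsBranchSet p n Z' → Y' = Prod.mk i '' Z' →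
        leafRank p Y'.ncard = leafRank p Y.ncard + 1 := by
      rintro i Z' hZ' rfl
      obtain ⟨Z, hZZ', rfl⟩ := Set.subset_image_iff.1 hlt.subset
      have hinj := Prod.mk_right_injective (β := TreeLeaf p n) i
      rw [TreeLeaf.ncard_mk_image, TreeLeaf.ncard_mk_image]
      refine ih hY.of_mk_image hZ' ((hinj.injOn.image_ssubset_image_iff (Set.subset_univ _) (Set.subset_univ _)).1 hlt) fun W hW h1 h2 => ?_
      rcases hcov _ (Or.inl ⟨i, W, hW, rfl⟩) (Set.image_mono h1) (Set.image_mono h2) with h | h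
      · exact Or.inl (hinj.image_injective h)
      · exact Or.inr (hinj.image_injective h)
    rcases hY' with ⟨i, Z', hZ', h⟩ | ⟨S', rfl⟩
    · exact inner i Z' hZ' h
    rcases S'.subsingleton_or_nontrivial with hS' | hS'
    · rcases hS'.eq_empty_or_singleton with rfl | ⟨i, rfl⟩
      · exact absurd hlt.subset (fun h => hlt.not_subset (Set.empty_subset _))
      · exact inner i Set.univ (IsBranchSet.univ p n) (TreeLeaf.mk_image_univ i).symm
    have hpos : 0 < p := by omega
    have hsub := fun S T => TreeLeaf.fst_preimage_subset_iff (n := n) hpos (S := S) (T := T)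
    have hinj : ∀ S T : Set (Fin p), (Prod.fst ⁻¹' S : Set (TreeLeaf p (n + 1))) = Prod.fst ⁻¹' T →
        S = T := fun S T h => ((hsub _ _).1 h.le).antisymm ((hsub _ _).1 h.ge)
    -- Within a single block, Y is that block: the block lies between Y and Y' and is not Y'.
    have single : ∀ i ∈ S', Y ⊆ Prod.fst ⁻¹' {i} → Y = Prod.fst ⁻¹' {i} := by
      intro i hi h
      refine ((hcov (Prod.fst ⁻¹' {i}) (Or.inr ⟨_, rfl⟩) h
        ((hsub _ _).2 (Set.singleton_subset_iff.2 hi))).resolve_right fun h => ?_).symm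
      rw [← hinj _ _ h] at hS'
      exact Set.not_nontrivial_singleton hS'
    obtain ⟨S, hS, rfl⟩ : ∃ S : Set (Fin p), S.Nonempty ∧ Y = Prod.fst ⁻¹' S := by
      rcases Y.eq_empty_or_nonempty with rfl | ⟨u, hu⟩
      -- This case cannot occur, but the equality supplied by `single` is all that is needed.
      · obtain ⟨a, ha⟩ := hS'.nonempty
        exact ⟨{a}, Set.singleton_nonempty a, single a ha (Set.empty_subset _)⟩
      · rcases hY with ⟨i, Z, hZ, rfl⟩ | ⟨S, rfl⟩
        · obtain ⟨f, hf, rfl⟩ := hu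
          refine ⟨{i}, Set.singleton_nonempty i, single i (hlt.subset ⟨f, hf, rfl⟩) ?_⟩
          rintro _ ⟨g, -, rfl⟩
          rfl
        · exact ⟨S, ⟨_, hu⟩, rfl⟩
    obtain ⟨b, hbS', hbS⟩ : ∃ b ∈ S', b ∉ S := by
      obtain ⟨u, hu, hu'⟩ := Set.exists_of_ssubset hlt
      exact ⟨u.1, hu, hu'⟩
    have hSS' : S ⊆ S' := (hsub _ _).1 hlt.subset
    have hins : insert b S = S' := by
      rcases hcov (Prod.fst ⁻¹' (insert b S)) (Or.inr ⟨_, rfl⟩)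
        ((hsub _ _).2 (Set.subset_insert b S))
        ((hsub _ _).2 (Set.insert_subset hbS' hSS')) with h | h
      · exact absurd (hinj _ _ h ▸ Set.mem_insert b S) hbS
      · exact hinj _ _ h
    have hcard : S'.ncard = S.ncard + 1 := by rw [← hins, Set.ncard_insert_of_notMem hbS]
    have h1 : 1 ≤ S.ncard := (Set.ncard_pos).2 hS
    have h2 : S'.ncard ≤ p := by simpa using Set.ncard_le_ncard S'.subset_univ
    rw [TreeLeaf.ncard_fst_preimage, TreeLeaf.ncard_fst_preimage,
      leafRank_mul_pow hp (by omega) h2, leafRank_mul_pow hp h1 (by omega), hcard, add_assoc]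

/-- `W` stands for the vertices at depth d, and `node w S` for the leaves below the children of w
indexed by S. -/
theorem IsBranchSet.exists_level {p : ℕ} (hp : 1 < p) (j d : ℕ) :
    ∃ (W : Type) (node : W → Set (Fin p) → Set (TreeLeaf p (j + 1 + d))),
      Nat.card W = p ^ d ∧ (∀ w S, IsBranchSet p (j + 1 + d) (node w S)) ∧
      (∀ w S, (node w S).ncard = S.ncard * p ^ j) ∧
      (∀ w S w' S', S.Nonempty → (node w S ⊆ node w' S' ↔ w = w' ∧ S ⊆ S')) ∧
      ∀ Y, IsBranchSet p (j + 1 + d) Y → ∀ s, 1 ≤ s → s < p → Y.ncard = s * p ^ j →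
        ∃ w S, node w S = Y := by
  have hpos : 0 < p := by omega
  induction d with
  | zero =>
    refine ⟨Unit, fun _ S => Prod.fst ⁻¹' S, Nat.card_unique, fun _ S => Or.inr ⟨S, rfl⟩,
      fun _ S => TreeLeaf.ncard_fst_preimage S, fun _ S _ S' _ => ?_, ?_⟩
    · exact (TreeLeaf.fst_preimage_subset_iff hpos).trans (by simp)
    · rintro Y (⟨i, Z, -, rfl⟩ | ⟨S, rfl⟩) s hs hsp hcard
      · refine ⟨(), {i}, ?_⟩
        rw [TreeLeaf.ncard_mk_image] at hcard
        have hZ : Z = Set.univ := by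
          refine Set.eq_of_subset_of_ncard_le Z.subset_univ ?_
          rw [hcard]
          exact (TreeLeaf.ncard_univ p j).le.trans (Nat.le_mul_of_pos_left _ hs)
        rw [hZ]
        exact (TreeLeaf.mk_image_univ i).symm
      · exact ⟨(), S, rfl⟩
  | succ d ih =>
    obtain ⟨W, node, hW, hbranch, hcard, hle, hsurj⟩ := ih
    refine ⟨Fin p × W, fun w S => Prod.mk w.1 '' node w.2 S, ?_,
      fun w S => Or.inl ⟨w.1, _, hbranch w.2 S, rfl⟩,
      fun w S => (TreeLeaf.ncard_mk_image _ _).trans (hcard _ _), ?_, ?_⟩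
    · rw [Nat.card_prod, hW, Nat.card_fin, pow_succ']
    · rintro ⟨i, w⟩ S ⟨i', w'⟩ S' hS
      rw [Prod.mk.injEq, and_assoc, ← hle w S w' S' hS]
      constructor
      · intro h
        obtain ⟨f, hf⟩ : (node w S).Nonempty := by
          rw [← Set.ncard_pos, hcard]
          exact Nat.mul_pos ((Set.ncard_pos).2 hS) (pow_pos hpos j)
        obtain ⟨g, -, hg⟩ := h ⟨f, hf, rfl⟩
        obtain rfl : i' = i := congrArg Prod.fst hg
        exact ⟨rfl, (Set.image_subset_image_iff (Prod.mk_right_injective i')).1 h⟩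
      · rintro ⟨rfl, h⟩
        exact Set.image_mono h
    · rintro Y (⟨i, Z, hZ, rfl⟩ | ⟨S, rfl⟩) s hs hsp hY
      · rw [TreeLeaf.ncard_mk_image] at hY
        obtain ⟨w, S, rfl⟩ := hsurj Z hZ s hs hsp hY
        exact ⟨(i, w), S, rfl⟩
      -- Unions of blocks at a vertex higher up have size divisible by p^(j+1), which would make p
      -- divide s.
      · exfalso
        have h1 : S.ncard * p ^ (j + 1 + d) = s * p ^ j :=
          (TreeLeaf.ncard_fst_preimage (n := j + 1 + d) S).symm.trans hY
        rw [add_assoc, pow_add, mul_left_comm, mul_comm s] at h1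
        have h2 := Nat.eq_of_mul_eq_mul_left (pow_pos hpos j) h1
        have h3 : p ∣ s := h2 ▸ Dvd.dvd.mul_left (dvd_pow_self p (by omega)) _
        exact absurd (Nat.le_of_dvd hs h3) (by omega)

/-! ### Rank functions and purity of finite posets. -/

section

variable {P : Type*} [PartialOrder P] [Finite P] {n : ℕ} {ρ : P → ℕ}

theorem IsRankFunction.strictMono (hρ : IsRankFunction n ρ) : StrictMono ρ := by
  classical
  have := Fintype.ofFinite P
  let _ : LocallyFiniteOrder P := Fintype.toLocallyFiniteOrder
  exact (strictMono_iff_forall_covBy ρ).2 fun x y h => by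
    rw [hρ.eq_add_one_of_covBy x y h]
    exact Nat.lt_succ_self _

theorem IsRankFunction.eq {ρ' : P → ℕ} (hρ' : IsRankFunction n ρ') (hρ : IsRankFunction n ρ) :
    ρ' = ρ := by
  funext x
  induction x using WellFoundedLT.induction with
  | ind x ih =>
    by_cases hx : IsMin x
    · rw [hρ.eq_zero_of_isMin x hx, hρ'.eq_zero_of_isMin x hx]
    · obtain ⟨y, hy⟩ := exists_covBy_of_wellFoundedGT hx
      rw [hρ.eq_add_one_of_covBy y x hy, hρ'.eq_add_one_of_covBy y x hy, ih y hy.lt]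

theorem IsMaxChain.exists_covBy_mem {c : Set P} (hc : IsMaxChain (· ≤ ·) c) {a b : P} (ha : a ∈ c)
    (hb : b ∈ c) (hab : a < b) : ∃ d ∈ c, a ⋖ d := by
  obtain ⟨d, ⟨hd, had⟩, hmin⟩ := (Set.toFinite {d | d ∈ c ∧ a < d}).exists_minimal ⟨b, hb, hab⟩
  refine ⟨d, hd, had, fun z haz hzd => ?_⟩
  have hchain : IsChain (· ≤ ·) (insert z c) := by
    refine hc.1.insert fun e he _ => ?_
    rcases hc.1.total he ha with h | h
    · exact Or.inr (h.trans haz.le)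
    · rcases h.eq_or_lt with rfl | h
      · exact Or.inr haz.le
      · rcases hc.1.total he hd with h' | h'
        · exact Or.inl (hzd.le.trans (hmin ⟨he, h⟩ h'))
        · exact Or.inl (hzd.le.trans h')
  have hz : z ∈ c := (hc.2 hchain (Set.subset_insert z c)).ge (Set.mem_insert z c)
  exact hzd.not_ge (hmin ⟨hz, haz⟩ hzd.le)

/-- Each non-top element of a maximal chain is covered by another element of the chain, so ρ maps
the chain bijectively onto 0, ..., n. -/
theorem IsRankFunction.isPureOfLength [BoundedOrder P] (hρ : IsRankFunction n ρ)
    (htop : ρ ⊤ = n) : IsPureOfLength P n := by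
  intro c hc
  have himage : ρ '' c = Set.Iic n := by
    refine Set.Subset.antisymm (Set.image_subset_iff.2 fun x _ => hρ.le_length x) fun m hm => ?_
    induction m with
    | zero => exact ⟨⊥, hc.bot_mem, hρ.eq_zero_of_isMin _ isMin_bot⟩
    | succ m ih =>
      obtain ⟨a, ha, rfl⟩ := ih (Nat.le_of_succ_le hm)
      have hlt : a < ⊤ := lt_top_iff_ne_top.2 fun h => by
        rw [h, htop] at hm
        exact absurd (Set.mem_Iic.1 hm) (by omega)
      obtain ⟨d, hd, had⟩ := hc.exists_covBy_mem ha hc.top_mem hlt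
      exact ⟨d, hd, hρ.eq_add_one_of_covBy a d had⟩
  have hinj : Set.InjOn ρ c := fun a ha b hb h => by
    rcases hc.1.total ha hb with hab | hab
    · exact hab.eq_of_not_lt fun hlt => (hρ.strictMono hlt).ne h
    · exact (hab.eq_of_not_lt fun hlt => (hρ.strictMono hlt).ne h.symm).symm
  rw [← hinj.encard_image, himage, ← Finset.coe_Iic, Set.encard_coe_eq_coe_finsetCard,
    Nat.card_Iic]
  rfl

end

section

variable {P Q : Type*} [PartialOrder P] [PartialOrder Q]

theorem IsPureOfLength.of_orderIso {n : ℕ} (f : P ≃o Q) (h : IsPureOfLength Q n) : IsPureOfLength P n := fun c hc => by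
  rw [← h _ (hc.image f), Function.Injective.encard_image]
  exact f.injective

theorem IsRankFunction.comp_orderIso (f : P ≃o Q) {n : ℕ} {ρ : Q → ℕ} (hρ : IsRankFunction n ρ) :
    IsRankFunction n (ρ ∘ f) where
  le_length x := hρ.le_length (f x)
  eq_zero_of_isMin _ hx := hρ.eq_zero_of_isMin _ (f.isMin_apply.2 hx)
  eq_add_one_of_covBy _ _ h := hρ.eq_add_one_of_covBy _ _ ((apply_covBy_apply_iff f).2 h)

/-- An order isomorphism restricts to the subtypes cut out by corresponding predicates. -/
def OrderIso.restrictSubtype (f : P ≃o Q) (A : Q → Prop) : {x : P // A (f x)} ≃o {y : Q // A y} where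
  toEquiv := f.toEquiv.subtypeEquiv fun _ => Iff.rfl
  map_rel_iff' := f.map_rel_iff

end

/-! ### The rank of branch sets and its bands. -/

section

variable {p n : ℕ}

/-- The rank of a branch set. -/
noncomputable def branchRank (p n : ℕ) (Y : {Y : Set (TreeLeaf p n) // IsBranchSet p n Y}) : ℕ :=
  leafRank p Y.1.ncard

instance branchSetBoundedOrder (p n : ℕ) : BoundedOrder {Y : Set (TreeLeaf p n) // IsBranchSet p n Y} where
  top := ⟨Set.univ, IsBranchSet.univ p n⟩
  le_top Y := Y.1.subset_univ
  bot := ⟨∅, IsBranchSet.empty p n⟩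
  bot_le Y := Y.1.empty_subset

theorem branchRank_top (hp : 1 < p) : branchRank p n ⊤ = (p - 1) * n + 1 := by
  change leafRank p (Set.univ : Set (TreeLeaf p n)).ncard = _
  rw [TreeLeaf.ncard_univ, ← one_mul (p ^ n), leafRank_mul_pow hp le_rfl hp.le]

theorem isRankFunction_branchRank (hp : 1 < p) :
    IsRankFunction ((p - 1) * n + 1) (branchRank p n) where
  le_length := by
    rintro ⟨Y, hY⟩
    rcases Y.eq_empty_or_nonempty with rfl | hne
    · simp [branchRank, leafRank_zero]
    · obtain ⟨s, j, h1, h2, h3, h4, h5⟩ := hY.exists_ncard_eq hp hne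
      rw [branchRank, h3, leafRank_mul_pow hp h1 h2.le]
      rcases h4.lt_or_eq with h | h
      · have := Nat.mul_le_mul_left (p - 1) (Nat.succ_le_of_lt h)
        rw [Nat.mul_succ] at this
        omega
      · rw [h, h5 h]
  eq_zero_of_isMin Y hY := by
    rw [isMin_iff_eq_bot.1 hY]
    change leafRank p (∅ : Set (TreeLeaf p n)).ncard = 0
    rw [Set.ncard_empty, leafRank_zero]
  eq_add_one_of_covBy Y Y' h := by
    refine Y.2.leafRank_of_cover hp Y'.2 h.lt fun W hW h1 h2 => ?_
    exact (h.eq_or_eq (c := ⟨W, hW⟩) h1 h2).imp (congrArg Subtype.val) (congrArg Subtype.val)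

theorem eq_of_leafRank_mem_Icc {s i j : ℕ} (hs : 1 ≤ s) (hsp : s < p)
    (h1 : (p - 1) * j + 1 ≤ (p - 1) * i + s) (h2 : (p - 1) * i + s ≤ (p - 1) * (j + 1)) :
    i = j := by
  rcases lt_trichotomy i j with h | h | h
  · have := Nat.mul_le_mul_left (p - 1) (Nat.succ_le_of_lt h)
    rw [Nat.mul_succ] at this
    omega
  · exact h
  · have : (p - 1) * (j + 1) ≤ (p - 1) * i := Nat.mul_le_mul_left _ h
    omega

theorem nonempty_level_orderIso (hp : 1 < p) {k : ℕ} (hk : 1 ≤ k) (hkn : k ≤ n) :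
    Nonempty ({Y // (p - 1) * (k - 1) + 1 ≤ branchRank p n Y ∧ branchRank p n Y ≤ (p - 1) * k} ≃o
      Copies (p ^ (n - k)) (ProperPart (Set (Fin p)))) := by
  -- With j = k - 1 and d = n - k, the tree has depth j + 1 + d, as `IsBranchSet.exists_level`
  -- requires.
  obtain ⟨j, rfl⟩ := Nat.exists_eq_add_of_le' hk
  obtain ⟨d, rfl⟩ := Nat.exists_eq_add_of_le hkn
  rw [Nat.add_sub_cancel, Nat.add_sub_cancel_left]
  have hpos : 0 < p := by omega
  obtain ⟨W, node, hW, hbranch, hcard, hle, hsurj⟩ := IsBranchSet.exists_level hp j d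
  have : Finite W := Nat.finite_of_card_ne_zero (by rw [hW]; exact (pow_pos hpos d).ne')
  let w : Fin (p ^ d) ≃ W := (Finite.equivFinOfCardEq hW).symm
  have hproper : ∀ S : Set (Fin p), S ≠ ∅ ∧ S ≠ Set.univ ↔ 1 ≤ S.ncard ∧ S.ncard < p := by
    intro S
    rw [← Set.nonempty_iff_ne_empty, ← Set.ncard_pos (s := S), ← Set.ssubset_univ_iff]
    refine and_congr Iff.rfl ⟨fun h => by simpa using Set.ncard_lt_ncard h, fun h => ?_⟩
    refine Set.ssubset_univ_iff.2 fun h' => ?_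
    rw [h', Set.ncard_univ, Nat.card_fin] at h
    exact lt_irrefl _ h
  have hrange : ∀ (x : Copies (p ^ d) (ProperPart (Set (Fin p)))),
      (p - 1) * j + 1 ≤ branchRank p (j + 1 + d) ⟨node (w x.1) x.2.1, hbranch _ _⟩ ∧
        branchRank p (j + 1 + d) ⟨node (w x.1) x.2.1, hbranch _ _⟩ ≤ (p - 1) * (j + 1) := by
    intro x
    obtain ⟨h1, h2⟩ := (hproper x.2.1).1 x.2.2
    simp only [branchRank]
    rw [hcard, leafRank_mul_pow hp h1 h2.le, Nat.mul_succ]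
    omega
  refine ⟨(RelIso.ofSurjective (OrderEmbedding.ofMapLEIff
    (fun x : Copies (p ^ d) (ProperPart (Set (Fin p))) => ⟨⟨_, hbranch _ _⟩, hrange x⟩) ?_) ?_).symm⟩
  · rintro ⟨a, S, hS⟩ ⟨b, T, hT⟩
    refine (hle (w a) S (w b) T (Set.nonempty_iff_ne_empty.2 hS.1)).trans ?_
    rw [w.injective.eq_iff]
    constructor
    · rintro ⟨rfl, h⟩
      exact Sigma.LE.fiber a _ _ h
    · rintro ⟨⟩
      exact ⟨rfl, by assumption⟩
  · rintro ⟨⟨Y, hY⟩, h1, h2⟩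
    change (p - 1) * j + 1 ≤ leafRank p Y.ncard at h1
    change leafRank p Y.ncard ≤ (p - 1) * (j + 1) at h2
    have hne : Y.Nonempty := by
      by_contra h
      rw [Set.not_nonempty_iff_eq_empty.1 h, Set.ncard_empty, leafRank_zero] at h1
      omega
    obtain ⟨s, i, hs, hsp, hYcard, -, -⟩ := hY.exists_ncard_eq hp hne
    rw [hYcard, leafRank_mul_pow hp hs hsp.le] at h1 h2
    -- Since 1 ≤ s < p, the band determines the exponent, so Y comes from a vertex of the chosen
    -- level.
    obtain rfl := eq_of_leafRank_mem_Icc hs hsp h1 h2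
    obtain ⟨v, S, rfl⟩ := hsurj Y hY s hs hsp hYcard
    have hS : S.ncard = s := by
      rw [hcard] at hYcard
      exact Nat.eq_of_mul_eq_mul_right (pow_pos hpos i) hYcard
    refine ⟨⟨w.symm v, S, (hproper S).2 (by omega)⟩, Subtype.ext (Subtype.ext ?_)⟩
    change node (w (w.symm v)) S = node v S
    rw [w.apply_symm_apply]

end

theorem mainTheorem9 (G : Type*) [Group G] [Finite G] (hG : Group.IsNilpotent G)
    (p t : ℕ) (hp : p.Prime) (ht : 2 < t)
    (hpart : p ^ (Nat.card G).factorization p = p ^ t)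
    (C : ConjClasses G) (hC : Nat.card C.carrier = p ^ (t - 2)) :
    IsPureOfLength (Subrack (ConjClassRack C)) ((p - 1) * (t - 2) + 1) ∧
    ∃ ρ : Subrack (ConjClassRack C) → ℕ,
      IsRankFunction ((p - 1) * (t - 2) + 1) ρ ∧
      (∀ ρ' : Subrack (ConjClassRack C) → ℕ,
        IsRankFunction ((p - 1) * (t - 2) + 1) ρ' → ρ' = ρ) ∧
      ∀ k : ℕ, 1 ≤ k → k ≤ t - 2 →
        Nonempty
          ({x : Subrack (ConjClassRack C) //
              (p - 1) * (k - 1) + 1 ≤ ρ x ∧ ρ x ≤ (p - 1) * k} ≃o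
            Copies (p ^ (t - 2 - k)) (ProperPart (Set (Fin p)))) := by
  have hfac : (Nat.card G).factorization p = t - 2 + 2 := by
    rw [Nat.pow_right_injective hp.two_le hpart]
    omega
  obtain ⟨f⟩ := nonempty_subrack_orderIso hG hp hfac C hC
  have : Finite (Subrack (ConjClassRack C)) := Finite.of_equiv _ f.symm.toEquiv
  have hρ := isRankFunction_branchRank (n := t - 2) hp.one_lt
  refine ⟨(hρ.isPureOfLength (branchRank_top hp.one_lt)).of_orderIso f,
    branchRank p (t - 2) ∘ f, hρ.comp_orderIso f,
    fun ρ' hρ' => hρ'.eq (hρ.comp_orderIso f), fun k hk hkt => ?_⟩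
  obtain ⟨g⟩ := nonempty_level_orderIso hp.one_lt hk hkt
  exact ⟨(f.restrictSubtype fun Y => (p - 1) * (k - 1) + 1 ≤ branchRank p (t - 2) Y ∧
    branchRank p (t - 2) Y ≤ (p - 1) * k).trans g⟩
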